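/- **Conventions.** An $\mathbb{R}$-tree is a metric space in which any two points $x,y$ are joined by a unique arc (a topologically embedded compact interval, up to reparametrisation), and this arc is a geodesic of length $d(x,y)$. A simplicial tree is a simplicial complex of dimension at most $1$ (a single vertex is allowed) that is an $\mathbb{R}$-tree under the path metric for which each edge is isometric to $[0,1]$. For $L\geqslant 1$ and $C\geqslant 0$, a map $f:X\to Y$ of metric spaces is an $(L,C)$-quasi-isometry if $\frac1L d_X(x_1,x_2)-C\leqslant d_Y(f(x_1),f(x_2))\leqslant L\,d_X(x_1,x_2)+C$ for all $x_1,x_2\in X$, and every $y\in Y$ satisfies $d_Y(f(x),y)\leqslant C$ for some $x\in X$. An $(L,C)$-quasi-action of a group $G$ on $X$ is a map $A:G\times X\to X$ such that every $A(g,-)$ is an $(L,C)$-quasi-isometry and $d_X(A(g,A(h,x)),A(gh,x))\leqslant C$ for all $g,h\in G$ and $x\in X$. It is cobounded if there is $D\geqslant 0$ such that for all $x,y\in X$ some $g\in G$ satisfies $d_X(A(g,x),y)\leqslant D$. Quasi-actions $A$ of $G$ on $X$ and $B$ of $G$ on $Y$ are quasi-conjugate if there are a map $f:X\to Y$ that is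 an $(L_0,C_0)$-quasi-isometry for some $L_0\geqslant 1$, $C_0\geqslant 0$, and a constant $D\geqslant 0$, such that $d_Y(f(A(g,x)),B(g,f(x)))\leqslant D$ for all $g\in G$ and $x\in X$. **Proposition.** Let $G$ be a finitely generated group, let $L\geqslant 1$ and $C\geqslant 0$, and let $A$ be a cobounded $(L,C)$-quasi-action of $G$ on a simplicial tree $\Gamma$. Then there exist a simplicial tree $\Gamma'$, a constant $C'\geqslant 0$, and a $(1,C')$-quasi-action $B$ of $G$ on $\Gamma'$ such that $A$ and $B$ are quasi-conjugate. -/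

import Mathlib

universe u v w

namespace QuasiTree

/-! ### Real trees -/

/-- A metric space is an `ℝ`-tree if any two points `x, y` are joined by a geodesic `α`, and every
topologically embedded interval with endpoints `x` and `y` has the same image as `α`
(so that `α` is the only arc from `x` to `y`, up to reparametrisation). -/
def IsRealTree (X : Type u) [MetricSpace X] : Prop :=
  ∀ x y : X, ∃ α : ℝ → X,
    α 0 = x ∧ α (dist x y) = y ∧
    (∀ s ∈ Set.Icc 0 (dist x y), ∀ t ∈ Set.Icc 0 (dist x y), dist (α s) (α t) = |s - t|) ∧
    ∀ (r : ℝ) (β : ℝ → X), 0 ≤ r → Topology.IsEmbedding ((Set.Icc 0 r).domRestrict β) →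
      β 0 = x → β r = y → β '' Set.Icc 0 r = α '' Set.Icc 0 (dist x y)

/-! ### One-dimensional simplicial complexes

A simplicial complex of dimension at most one is the same thing as a simple graph: its simplices
are the vertices and the edges. -/

/-- The simplices of the complex: `{v}` for a vertex `v`, and `{a, b}` for an edge `ab`. -/
def IsSimplex {V : Type u} (K : SimpleGraph V) (σ : Set V) : Prop :=
  (∃ v, σ = {v}) ∨ ∃ a b, K.Adj a b ∧ σ = {a, b}

/-- The geometric realization, in barycentric coordinates: finitely supported non-negative weights
on the vertices, of total weight one, whose support is a simplex. -/
structure Realization {V : Type u} (K : SimpleGraph V) : Type u where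
  coord : V →₀ ℝ
  nonneg : ∀ v, 0 ≤ coord v
  sum_eq_one : (coord.sum fun _ a => a) = 1
  isSimplex_support : IsSimplex K (coord.support : Set V)

namespace Realization

variable {V : Type u} {K : SimpleGraph V}

/-- Two points lie in a common closed simplex. -/
def InCommonSimplex (x y : Realization K) : Prop :=
  ∃ σ : Set V, IsSimplex K σ ∧ (x.coord.support : Set V) ⊆ σ ∧ (y.coord.support : Set V) ⊆ σ

/-- The distance between two points of a common closed simplex, each edge having length one:
for `x = (1 - s) a + s b` and `y = (1 - t) a + t b` this is `|s - t|`. -/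
noncomputable def simplexDist (x y : Realization K) : ℝ :=
  (1 / 2) * ((x.coord - y.coord).sum fun _ a => |a|)

/-- The path metric in which each edge is isometric to `[0, 1]`: the infimum of the lengths of the
polygonal paths `p 0, p 1, …, p n` from `x` to `y`, where consecutive points lie in a common
closed simplex (and `∞` if there is no such path). -/
noncomputable def pathEDist (x y : Realization K) : ENNReal :=
  ⨅ (n : ℕ) (p : ℕ → Realization K) (_ : p 0 = x) (_ : p n = y)
    (_ : ∀ i < n, InCommonSimplex (p i) (p (i + 1))),
    ∑ i ∈ Finset.range n, ENNReal.ofReal (simplexDist (p i) (p (i + 1)))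

end Realization

/-- A metric space is a simplicial tree if it is (isometric to) the realization of a one-dimensional
simplicial complex with its path metric, and is an `ℝ`-tree. -/
def IsSimplicialTree (X : Type u) [MetricSpace X] : Prop :=
  IsRealTree X ∧
    ∃ (V : Type u) (K : SimpleGraph V) (φ : X ≃ Realization K),
      ∀ x y : X, edist x y = Realization.pathEDist (φ x) (φ y)

/-! ### Quasi-isometries and quasi-actions -/

/-- `f` is an `(L, C)`-quasi-isometry. -/
structure IsQuasiIsometry {X : Type u} {Y : Type v} [MetricSpace X] [MetricSpace Y]
    (L C : ℝ) (f : X → Y) : Prop where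
  one_le : 1 ≤ L
  nonneg : 0 ≤ C
  lower : ∀ x₁ x₂, (1 / L) * dist x₁ x₂ - C ≤ dist (f x₁) (f x₂)
  upper : ∀ x₁ x₂, dist (f x₁) (f x₂) ≤ L * dist x₁ x₂ + C
  coarsely_surjective : ∀ y, ∃ x, dist (f x) y ≤ C

/-- `A` is an `(L, C)`-quasi-action of the group `G` on `X`. -/
structure IsQuasiAction {G : Type v} [Group G] {X : Type u} [MetricSpace X]
    (L C : ℝ) (A : G → X → X) : Prop where
  one_le : 1 ≤ L
  nonneg : 0 ≤ C
  quasiIsometry : ∀ g, IsQuasiIsometry L C (A g)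
  dist_mul_le : ∀ g h x, dist (A g (A h x)) (A (g * h) x) ≤ C

/-- The quasi-action `A` is cobounded. -/
def IsCobounded {G : Type v} {X : Type u} [MetricSpace X] (A : G → X → X) : Prop :=
  ∃ D : ℝ, 0 ≤ D ∧ ∀ x y, ∃ g, dist (A g x) y ≤ D

/-- `f` is coarsely equivariant with respect to `A` and `B`. -/
def IsCoarselyEquivariant {G : Type v} {X : Type u} {Y : Type w} [MetricSpace Y]
    (A : G → X → X) (B : G → Y → Y) (f : X → Y) : Prop :=
  ∃ D : ℝ, 0 ≤ D ∧ ∀ x g, dist (f (A g x)) (B g (f x)) ≤ D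

/-- `f` is a quasi-conjugacy from `A` to `B`: a coarsely equivariant quasi-isometry. -/
def IsQuasiConjugacy {G : Type v} {X : Type u} {Y : Type w} [MetricSpace X] [MetricSpace Y]
    (A : G → X → X) (B : G → Y → Y) (f : X → Y) : Prop :=
  IsCoarselyEquivariant A B f ∧ ∃ L C : ℝ, IsQuasiIsometry L C f

/-- The quasi-actions `A` and `B` are quasi-conjugate. -/
def AreQuasiConjugate {G : Type v} {X : Type u} {Y : Type w} [MetricSpace X] [MetricSpace Y]
    (A : G → X → X) (B : G → Y → Y) : Prop :=
  ∃ f : X → Y, IsQuasiConjugacy A B f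

end QuasiTree

namespace QuasiTree

/-- The four-point condition: `Y` is `0`-hyperbolic in the sense of Gromov. -/
def FourPoint (Y : Type u) [PseudoMetricSpace Y] : Prop :=
  ∀ x y z w : Y, dist x y + dist z w ≤ max (dist x z + dist y w) (dist x w + dist y z)

/-- Any two points are joined by a geodesic. -/
def IsGeodesicSpace (Y : Type u) [PseudoMetricSpace Y] : Prop :=
  ∀ x y : Y, ∃ α : ℝ → Y, α 0 = x ∧ α (dist x y) = y ∧
    ∀ s ∈ Set.Icc 0 (dist x y), ∀ t ∈ Set.Icc 0 (dist x y), dist (α s) (α t) = |s - t|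

section FourPoint

variable {Y : Type u} [MetricSpace Y]

theorem FourPoint.dist_eq_of_between (h4 : FourPoint Y) {x y m n : Y}
    (hm : dist x m + dist m y = dist x y) (hn : dist x n + dist n y = dist x y) :
    dist m n = |dist x m - dist x n| := by
  apply le_antisymm
  · have := h4 m n x y
    rw [dist_comm m x, dist_comm n x] at this
    rcases le_max_iff.1 this with h | h
    · have : dist m n ≤ dist x m - dist x n := by linarith
      exact this.trans (le_abs_self _)
    · have : dist m n ≤ -(dist x m - dist x n) := by linarith
      exact this.trans (neg_le_abs _)
  · rw [dist_comm x m, dist_comm x n]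
    exact abs_dist_sub_le m n x

theorem isOpen_beyond (h4 : FourPoint Y) (x m : Y) :
    IsOpen {p : Y | p ≠ m ∧ dist x p = dist x m + dist m p} := by
  rw [Metric.isOpen_iff]
  rintro p ⟨hpm, hp⟩
  refine ⟨dist p m, dist_pos.2 hpm, fun q hq => ?_⟩
  rw [Metric.mem_ball] at hq
  have hqm : q ≠ m := by
    rintro rfl
    rw [dist_comm] at hq
    exact lt_irrefl _ hq
  refine ⟨hqm, le_antisymm (dist_triangle _ _ _) ?_⟩
  have := h4 x p m q
  rw [dist_comm p q, dist_comm p m] at this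
  rw [dist_comm p m] at hq
  have hpos : 0 < dist m q := dist_pos.2 hqm.symm
  rcases le_max_iff.1 this with h | h <;> linarith

theorem mem_image_of_between (h4 : FourPoint Y) {r : ℝ} {β : ℝ → Y} (hr : 0 ≤ r)
    (hβ : ContinuousOn β (Set.Icc 0 r)) {m : Y}
    (hm : dist (β 0) m + dist m (β r) = dist (β 0) (β r)) : m ∈ β '' Set.Icc 0 r := by
  by_contra hmem
  have h0 : β 0 ∈ β '' Set.Icc 0 r := ⟨0, ⟨le_rfl, hr⟩, rfl⟩
  have h1 : β r ∈ β '' Set.Icc 0 r := ⟨r, ⟨hr, le_rfl⟩, rfl⟩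
  have hne : ∀ p ∈ β '' Set.Icc 0 r, p ≠ m := fun p hp h => hmem (h ▸ hp)
  have hconn : IsPreconnected (β '' Set.Icc 0 r) := isPreconnected_Icc.image β hβ
  have hU : IsOpen {p : Y | dist (β 0) p < dist (β 0) m + dist m p} :=
    isOpen_lt (by fun_prop) (by fun_prop)
  obtain ⟨p, _, hp, hp'⟩ := hconn _ _ hU (isOpen_beyond h4 (β 0) m)
    (fun p hp => (dist_triangle (β 0) m p).lt_or_eq.imp id fun h => ⟨hne p hp, h⟩)
    ⟨β 0, h0, by
      have : 0 < dist (β 0) m := dist_pos.2 (hne _ h0)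
      simp only [Set.mem_ofPred_eq, dist_self]
      positivity⟩
    ⟨β r, h1, hne _ h1, hm.symm⟩
  exact hp.ne hp'.2

theorem isRealTree_of_fourPoint (h4 : FourPoint Y) (hg : IsGeodesicSpace Y) : IsRealTree Y := by
  intro x y
  obtain ⟨α, hα0, hα1, hα⟩ := hg x y
  refine ⟨α, hα0, hα1, hα, ?_⟩
  rintro r β hr hemb rfl rfl
  set D := dist (β 0) (β r) with hD
  have hD0 : 0 ≤ D := dist_nonneg
  have hβ : ContinuousOn β (Set.Icc 0 r) := continuousOn_iff_continuous_domRestrict.2 hemb.continuous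
  have hinj : Set.InjOn β (Set.Icc 0 r) := Set.injOn_iff_injective.2 hemb.injective
  have hsub : ∀ s ∈ Set.Icc 0 D, α s ∈ β '' Set.Icc 0 r := by
    intro s hs
    apply mem_image_of_between h4 hr hβ
    have h1 := hα 0 ⟨le_rfl, hD0⟩ s hs
    have h2 := hα s hs D ⟨hD0, le_rfl⟩
    rw [hα0] at h1
    rw [hα1] at h2
    rw [h1, h2, ← hD, zero_sub, abs_neg, abs_of_nonneg hs.1, abs_sub_comm,
      abs_of_nonneg (sub_nonneg.2 hs.2)]
    ring
  apply Set.Subset.antisymm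
  · choose! g hg hβg using hsub
    let g' : Set.Icc 0 D → Set.Icc 0 r := fun s => ⟨g s, hg s s.2⟩
    have hg' : Continuous g' := by
      rw [hemb.continuous_iff]
      have : (Set.Icc 0 r).domRestrict β ∘ g' = (Set.Icc 0 D).domRestrict α := by
        ext s
        exact hβg s s.2
      rw [this]
      refine (LipschitzWith.of_dist_le_mul (K := 1) fun s t => ?_).continuous
      rw [NNReal.coe_one, one_mul]
      exact (hα s s.2 t t.2).le
    have hg0 : g 0 = 0 := hinj (hg 0 ⟨le_rfl, hD0⟩) ⟨le_rfl, hr⟩ (by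
      rw [hβg 0 ⟨le_rfl, hD0⟩, hα0])
    have hg1 : g D = r := hinj (hg D ⟨hD0, le_rfl⟩) ⟨hr, le_rfl⟩ (by
      rw [hβg D ⟨hD0, le_rfl⟩, hα1])
    rintro _ ⟨t, ht, rfl⟩
    have : PreconnectedSpace (Set.Icc 0 D) := Subtype.preconnectedSpace isPreconnected_Icc
    obtain ⟨s, hs⟩ := mem_range_of_exists_le_of_exists_ge
      (f := fun s => (g' s : ℝ)) (c := t) (by fun_prop)
      ⟨⟨0, le_rfl, hD0⟩, by simpa [g', hg0] using ht.1⟩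
      ⟨⟨D, hD0, le_rfl⟩, by simpa [g', hg1] using ht.2⟩
    refine ⟨s, s.2, ?_⟩
    rw [← hβg s s.2, ← hs]
  · rintro _ ⟨s, hs, rfl⟩
    exact hsub s hs

end FourPoint

theorem Realization.ext {V : Type u} {K : SimpleGraph V} {x y : Realization K}
    (h : ∀ v, x.coord v = y.coord v) : x = y := by
  obtain ⟨c, _, _, _⟩ := x
  obtain ⟨d, _, _, _⟩ := y
  obtain rfl : c = d := Finsupp.ext h
  rfl

theorem Realization.simplexDist_self {V : Type u} {K : SimpleGraph V} (x : Realization K) :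
    simplexDist x x = 0 := by
  simp [simplexDist]

theorem Realization.pathEDist_self {V : Type u} {K : SimpleGraph V} (x : Realization K) :
    pathEDist x x = 0 := by
  refine le_antisymm ?_ bot_le
  refine iInf_le_of_le 0 (iInf_le_of_le (fun _ => x) ?_)
  simp

theorem Realization.pathEDist_le_add {V : Type u} {K : SimpleGraph V} {x y z : Realization K}
    (h : InCommonSimplex y z) :
    pathEDist x z ≤ pathEDist x y + ENNReal.ofReal (simplexDist y z) := by
  conv_rhs => rw [pathEDist]
  simp only [ENNReal.iInf_add]
  refine le_iInf fun n => le_iInf fun p => le_iInf fun h0 => le_iInf fun hn => le_iInf fun hp => ?_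
  let q : ℕ → Realization K := fun i => if i ≤ n then p i else z
  have hq : ∀ i ≤ n, q i = p i := fun i hi => if_pos hi
  have hqn : q (n + 1) = z := if_neg (by omega)
  refine iInf_le_of_le (n + 1) (iInf_le_of_le q (iInf_le_of_le ((hq 0 (by omega)).trans h0)
    (iInf_le_of_le hqn (iInf_le_of_le ?_ ?_))))
  · intro i hi
    rcases Nat.lt_succ_iff_lt_or_eq.1 hi with hi | rfl
    · rw [hq i hi.le, hq (i + 1) hi]
      exact hp i hi
    · rw [hq i le_rfl, hqn, hn]
      exact h
  · rw [Finset.sum_range_succ, hqn, hq n le_rfl, hn]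
    gcongr with i hi
    have hi := Finset.mem_range.1 hi
    rw [hq i hi.le, hq (i + 1) hi]

/-- The set `V` is the vertex set of a decomposition of `Y` into edges of length one: each point
lies on such an edge (or is a vertex), and no further vertex is at distance less than one. -/
def IsVertexSet {Y : Type u} [MetricSpace Y] (V : Set Y) : Prop :=
  ∀ y : Y, ∃ a ∈ V, ∃ b ∈ V, (a = b ∨ dist a b = 1) ∧ dist a y + dist y b = dist a b ∧
    ∀ v ∈ V, dist y v < 1 → v = a ∨ v = b

namespace IsVertexSet

variable {Y : Type u} [MetricSpace Y] {V : Set Y}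

theorem vertex_or_edge (hV : IsVertexSet V) (y : Y) :
    (y ∈ V ∧ ∀ v ∈ V, dist y v < 1 → v = y) ∨
    ∃ a ∈ V, ∃ b ∈ V, dist a b = 1 ∧ dist a y + dist y b = 1 ∧ dist y a < 1 ∧ dist y b < 1 ∧
      ∀ v ∈ V, dist y v < 1 → v = a ∨ v = b := by
  obtain ⟨a, ha, b, hb, hab, hy, hv⟩ := hV y
  by_cases hya : y = a
  · subst hya
    refine Or.inl ⟨ha, fun v hvV hd => ?_⟩
    rcases hv v hvV hd with h | h
    · exact h
    · subst h
      rcases hab with h | h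
      · exact h.symm
      · linarith
  by_cases hyb : y = b
  · subst hyb
    refine Or.inl ⟨hb, fun v hvV hd => ?_⟩
    rcases hv v hvV hd with h | h
    · subst h
      rcases hab with h | h
      · exact h
      · rw [dist_comm] at h; linarith
    · exact h
  have h1 : 0 < dist a y := dist_pos.2 (Ne.symm hya)
  have h2 : 0 < dist y b := dist_pos.2 hyb
  rcases hab with rfl | hab
  · rw [dist_self] at hy; linarith
  · rw [hab] at hy
    exact Or.inr ⟨a, ha, b, hb, hab, hy, by rw [dist_comm]; linarith, by linarith, hv⟩

/-- The graph on the vertices in which two vertices are adjacent if their distance is one. -/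
def unitGraph (V : Set Y) : SimpleGraph V where
  Adj a b := dist (a : Y) b = 1
  symm := ⟨fun a b h => by rwa [dist_comm]⟩
  loopless := ⟨fun a h => by simp at h⟩

theorem finite_near (hV : IsVertexSet V) (y : Y) :
    (Function.support fun v : V => max 0 (1 - dist y v)).Finite := by
  obtain ⟨a, ha, b, hb, -, -, hv⟩ := hV y
  refine (Set.toFinite {⟨a, ha⟩, ⟨b, hb⟩}).subset fun v hvs => ?_
  have : dist y v < 1 := by
    by_contra h
    exact hvs (max_eq_left (by linarith))
  rcases hv v v.2 this with h | h
  · exact Or.inl (Subtype.ext h)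
  · exact Or.inr (Subtype.ext h)

/-- The barycentric coordinates of a point: hat functions around the vertices. -/
noncomputable def hat (hV : IsVertexSet V) (y : Y) : V →₀ ℝ :=
  Finsupp.ofSupportFinite (fun v : V => max 0 (1 - dist y v)) (hV.finite_near y)

theorem hat_apply (hV : IsVertexSet V) (y : Y) (v : V) : hV.hat y v = max 0 (1 - dist y v) := rfl

theorem mem_support_hat (hV : IsVertexSet V) {y : Y} {v : V} :
    v ∈ (hV.hat y).support ↔ dist y v < 1 := by
  rw [Finsupp.mem_support_iff, hat_apply]
  constructor
  · intro h
    by_contra h'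
    exact h (max_eq_left (by linarith))
  · intro h
    rw [max_eq_right (by linarith)]
    linarith

theorem support_hat_of_edge (hV : IsVertexSet V) {y : Y} {a b : V}
    (ha : dist y a < 1) (hb : dist y b < 1)
    (h : ∀ v ∈ V, dist y v < 1 → v = a ∨ v = b) :
    ((hV.hat y).support : Set V) = {a, b} := by
  ext v
  rw [Finset.mem_coe, mem_support_hat]
  constructor
  · intro hv
    exact (h v v.2 hv).imp Subtype.ext Subtype.ext
  · rintro (rfl | rfl) <;> assumption

theorem support_hat_of_vertex (hV : IsVertexSet V) {y : Y} (hy : y ∈ V)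
    (h : ∀ v ∈ V, dist y v < 1 → v = y) :
    ((hV.hat y).support : Set V) = {⟨y, hy⟩} := by
  ext v
  rw [Finset.mem_coe, mem_support_hat]
  constructor
  · intro hv
    exact Subtype.ext (h v v.2 hv)
  · rintro rfl
    simp

/-- The point of the realization with the given hat coordinates. -/
noncomputable def toRealization (hV : IsVertexSet V) (y : Y) : Realization (unitGraph V) where
  coord := hV.hat y
  nonneg v := le_max_left _ _
  sum_eq_one := by
    classical
    rcases hV.vertex_or_edge y with ⟨hy, h⟩ | ⟨a, ha, b, hb, hab, hy, hya, hyb, h⟩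
    · have hs := hV.support_hat_of_vertex hy h
      rw [← Finset.coe_singleton, Finset.coe_inj] at hs
      rw [Finsupp.sum, hs, Finset.sum_singleton, hat_apply]
      simp
    · have hs := hV.support_hat_of_edge (a := ⟨a, ha⟩) (b := ⟨b, hb⟩) hya hyb h
      rw [← Finset.coe_pair, Finset.coe_inj] at hs
      have hne : (⟨a, ha⟩ : V) ≠ ⟨b, hb⟩ := by
        intro h
        rw [Subtype.mk.injEq] at h
        subst h
        simp at hab
      rw [Finsupp.sum, hs, Finset.sum_pair hne, hat_apply, hat_apply,
        max_eq_right (by simp only; linarith), max_eq_right (by simp only; linarith)]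
      rw [dist_comm a y] at hy
      simp only
      linarith
  isSimplex_support := by
    rcases hV.vertex_or_edge y with ⟨hy, h⟩ | ⟨a, ha, b, hb, hab, hy, hya, hyb, h⟩
    · exact Or.inl ⟨_, hV.support_hat_of_vertex hy h⟩
    · exact Or.inr ⟨⟨a, ha⟩, ⟨b, hb⟩, hab, hV.support_hat_of_edge hya hyb h⟩

theorem coord_toRealization (hV : IsVertexSet V) (y : Y) :
    (hV.toRealization y).coord = hV.hat y := rfl

theorem between_of_support_subset (hV : IsVertexSet V) {y : Y} {a b : V}
    (hab : dist (a : Y) b = 1) (h : ((hV.hat y).support : Set V) ⊆ {a, b}) :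
    dist (a : Y) y + dist y b = dist (a : Y) b := by
  rw [hab]
  rcases hV.vertex_or_edge y with ⟨hy, h'⟩ | ⟨c, hc, d, hd, hcd, hy, hyc, hyd, h'⟩
  · rw [hV.support_hat_of_vertex hy h', Set.singleton_subset_iff] at h
    rcases h with h | h
    · obtain rfl : y = a := congrArg Subtype.val h
      rw [dist_self, hab, zero_add]
    · obtain rfl : y = b := congrArg Subtype.val h
      rw [dist_self, hab, add_zero]
  · rw [hV.support_hat_of_edge (a := ⟨c, hc⟩) (b := ⟨d, hd⟩) hyc hyd h'] at h
    have h1 : c = a ∨ c = b := (h (Or.inl rfl)).imp (congrArg Subtype.val) (congrArg Subtype.val)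
    have h2 : d = a ∨ d = b := (h (Or.inr rfl)).imp (congrArg Subtype.val) (congrArg Subtype.val)
    have hne : c ≠ d := by
      rintro rfl
      rw [dist_self] at hcd
      norm_num at hcd
    rcases h1 with rfl | rfl <;> rcases h2 with rfl | rfl
    · exact absurd rfl hne
    · exact hy
    · rw [dist_comm (a : Y) y, dist_comm y (b : Y), add_comm]
      exact hy
    · exact absurd rfl hne

theorem eq_of_support_subset_singleton (hV : IsVertexSet V) {y : Y} {a : V}
    (h : ((hV.hat y).support : Set V) ⊆ {a}) : y = a := by
  rcases hV.vertex_or_edge y with ⟨hy, h'⟩ | ⟨c, hc, d, hd, hcd, hy, hyc, hyd, h'⟩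
  · rw [hV.support_hat_of_vertex hy h', Set.singleton_subset_iff] at h
    exact congrArg Subtype.val h
  · rw [hV.support_hat_of_edge (a := ⟨c, hc⟩) (b := ⟨d, hd⟩) hyc hyd h'] at h
    have h1 := congrArg Subtype.val (h (Or.inl rfl))
    have h2 := congrArg Subtype.val (h (Or.inr rfl))
    simp only at h1 h2
    rw [h1, h2, dist_self] at hcd
    norm_num at hcd

theorem simplexDist_toRealization (hV : IsVertexSet V) (h4 : FourPoint Y) {y z : Y}
    (h : Realization.InCommonSimplex (hV.toRealization y) (hV.toRealization z)) :
    Realization.simplexDist (hV.toRealization y) (hV.toRealization z) = dist y z := by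
  classical
  obtain ⟨σ, ⟨a, rfl⟩ | ⟨a, b, hab, rfl⟩, hy, hz⟩ := h
  · rw [hV.eq_of_support_subset_singleton hy, hV.eq_of_support_subset_singleton hz, dist_self,
      Realization.simplexDist_self]
  · have hy' := hV.between_of_support_subset hab hy
    have hz' := hV.between_of_support_subset hab hz
    rw [h4.dist_eq_of_between hy' hz']
    replace hab : dist (a : Y) b = 1 := hab
    have hne : a ≠ b := by
      rintro rfl
      rw [dist_self] at hab
      norm_num at hab
    have hsub : (hV.hat y - hV.hat z).support ⊆ {a, b} := by
      refine Finsupp.support_sub.trans (Finset.union_subset ?_ ?_) <;>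
      · rw [← Finset.coe_subset, Finset.coe_pair]
        assumption
    rw [Realization.simplexDist, coord_toRealization, coord_toRealization,
      Finsupp.sum_of_support_subset _ hsub _ (by simp), Finset.sum_pair hne]
    simp only [Finsupp.coe_sub, Pi.sub_apply, hat_apply]
    rw [hab] at hy' hz'
    have := @dist_nonneg _ _ (a : Y) y
    have := @dist_nonneg _ _ (a : Y) z
    have := @dist_nonneg _ _ y (b : Y)
    have := @dist_nonneg _ _ z (b : Y)
    rw [dist_comm y a, dist_comm z a, max_eq_right (by linarith), max_eq_right (by linarith),
      max_eq_right (by linarith), max_eq_right (by linarith), abs_sub_comm (dist _ _)]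
    have e1 : 1 - dist (a : Y) y - (1 - dist (a : Y) z) = dist (a : Y) z - dist (a : Y) y := by ring
    have e2 : 1 - dist y (b : Y) - (1 - dist z (b : Y)) = -(dist (a : Y) z - dist (a : Y) y) := by
      linarith
    rw [e1, e2, abs_neg]
    ring

theorem exists_pos_inCommonSimplex (hV : IsVertexSet V) (y : Y) :
    ∃ ε > 0, ∀ z, dist y z < ε →
      Realization.InCommonSimplex (hV.toRealization y) (hV.toRealization z) := by
  suffices ∃ ε > 0, ∀ z, dist y z < ε →
      ((hV.hat y).support : Set V) ⊆ ((hV.hat z).support : Set V) by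
    obtain ⟨ε, hε, h⟩ := this
    exact ⟨ε, hε, fun z hz => ⟨_, (hV.toRealization z).isSimplex_support, h z hz, subset_rfl⟩⟩
  rcases hV.vertex_or_edge y with ⟨hy, h⟩ | ⟨a, ha, b, hb, hab, hy, hya, hyb, h⟩
  · refine ⟨1, one_pos, fun z hz => ?_⟩
    rw [hV.support_hat_of_vertex hy h, Set.singleton_subset_iff, Finset.mem_coe, mem_support_hat]
    rwa [dist_comm]
  · refine ⟨min (1 - dist y a) (1 - dist y b), lt_min (by linarith) (by linarith), fun z hz => ?_⟩
    rw [hV.support_hat_of_edge (a := ⟨a, ha⟩) (b := ⟨b, hb⟩) hya hyb h]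
    rw [lt_min_iff, dist_comm] at hz
    rintro v (rfl | rfl) <;> rw [Finset.mem_coe, mem_support_hat]
    · have := dist_triangle z y a
      simp only
      linarith
    · have := dist_triangle z y b
      simp only
      linarith

theorem toRealization_injective (hV : IsVertexSet V) (h4 : FourPoint Y) :
    Function.Injective hV.toRealization := by
  intro y z h
  rw [← dist_eq_zero, ← hV.simplexDist_toRealization h4, h, Realization.simplexDist_self]
  exact ⟨_, (hV.toRealization y).isSimplex_support, subset_rfl, by rw [h]⟩

theorem toRealization_surjective (hV : IsVertexSet V) (hg : IsGeodesicSpace Y) :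
    Function.Surjective hV.toRealization := by
  classical
  intro x
  rcases x.isSimplex_support with ⟨a, ha⟩ | ⟨a, b, hab, hx⟩
  · refine ⟨a, Realization.ext fun v => ?_⟩
    have hxa : x.coord a = 1 := by
      have := x.sum_eq_one
      rw [← Finset.coe_singleton, Finset.coe_inj] at ha
      rwa [Finsupp.sum, ha, Finset.sum_singleton] at this
    rw [coord_toRealization, hat_apply]
    by_cases hva : v = a
    · subst hva
      simp [hxa]
    · have : x.coord v = 0 := by
        rw [← Finsupp.notMem_support_iff, ← Finset.mem_coe, ha]
        exact hva
      rw [this]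
      apply max_eq_left
      by_contra! hlt
      rcases hV.vertex_or_edge (a : Y) with ⟨-, h⟩ | ⟨c, hc, d, hd, hcd, hy, hyc, hyd, h⟩
      · exact hva (Subtype.ext (h v v.2 (by linarith)))
      · rcases h a a.2 (by simp) with h | h
        · rw [← h, dist_self] at hy
          linarith
        · rw [← h, dist_self, dist_comm] at hy
          linarith
  · replace hab : dist (a : Y) b = 1 := hab
    have hne : a ≠ b := by
      rintro rfl
      rw [dist_self] at hab
      norm_num at hab
    have hsum : x.coord a + x.coord b = 1 := by
      have := x.sum_eq_one
      rw [← Finset.coe_pair, Finset.coe_inj] at hx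
      rwa [Finsupp.sum, hx, Finset.sum_pair hne] at this
    have hpos : ∀ v ∈ (x.coord.support : Set V), 0 < x.coord v := fun v hv =>
      lt_of_le_of_ne (x.nonneg v) (Finsupp.mem_support_iff.1 hv).symm
    have hxa := hpos a (hx ▸ Or.inl rfl)
    have hxb := hpos b (hx ▸ Or.inr rfl)
    obtain ⟨α, h0, h1, hα⟩ := hg a b
    rw [hab] at h1 hα
    have hya := hα 0 (by simp) (1 - x.coord a) ⟨by linarith, by linarith⟩
    have hyb := hα (1 - x.coord a) ⟨by linarith, by linarith⟩ 1 (by simp)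
    rw [h0, zero_sub, abs_neg, abs_of_nonneg (by linarith), dist_comm] at hya
    rw [h1, abs_sub_comm, abs_of_nonneg (by linarith)] at hyb
    set y := α (1 - x.coord a)
    refine ⟨y, Realization.ext fun v => ?_⟩
    rw [coord_toRealization, hat_apply]
    by_cases hva : v = a
    · subst hva
      rw [hya, max_eq_right (by linarith)]
      ring
    by_cases hvb : v = b
    · subst hvb
      rw [hyb, max_eq_right (by linarith)]
      linarith
    have : x.coord v = 0 := by
      rw [← Finsupp.notMem_support_iff, ← Finset.mem_coe, hx]
      exact not_or.2 ⟨hva, hvb⟩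
    rw [this]
    apply max_eq_left
    by_contra! hlt
    have ha' : dist y a < 1 := by linarith
    have hb' : dist y b < 1 := by linarith
    have hv' : dist y v < 1 := by linarith
    rcases hV.vertex_or_edge y with ⟨-, h⟩ | ⟨c, hc, d, hd, hcd, hy, hyc, hyd, h⟩
    · exact hne (Subtype.ext ((h a a.2 ha').trans (h b b.2 hb').symm))
    · have e1 := h a a.2 ha'
      have e2 := h b b.2 hb'
      have e3 := h v v.2 hv'
      replace hne : (a : Y) ≠ b := fun h => hne (Subtype.ext h)
      replace hva : (v : Y) ≠ a := fun h => hva (Subtype.ext h)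
      replace hvb : (v : Y) ≠ b := fun h => hvb (Subtype.ext h)
      grind

theorem pathEDist_toRealization_le (hV : IsVertexSet V) (h4 : FourPoint Y)
    (hg : IsGeodesicSpace Y) (y z : Y) :
    Realization.pathEDist (hV.toRealization y) (hV.toRealization z) ≤ edist y z := by
  obtain ⟨α, h0, h1, hα⟩ := hg y z
  set D := dist y z with hD
  have hD0 : 0 ≤ D := dist_nonneg
  let S : Set ℝ := {s | s ∈ Set.Icc 0 D ∧
    Realization.pathEDist (hV.toRealization y) (hV.toRealization (α s)) ≤ ENNReal.ofReal s}
  have hstep : ∀ s ∈ S, ∀ t ∈ Set.Icc 0 D, s ≤ t →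
      Realization.InCommonSimplex (hV.toRealization (α s)) (hV.toRealization (α t)) → t ∈ S := by
    rintro s ⟨hs, hs'⟩ t ht hst hc
    refine ⟨ht, (Realization.pathEDist_le_add hc).trans ?_⟩
    rw [hV.simplexDist_toRealization h4 hc, hα s hs t ht, abs_sub_comm,
      abs_of_nonneg (sub_nonneg.2 hst)]
    refine (add_le_add_left hs' _).trans ?_
    rw [← ENNReal.ofReal_add hs.1 (sub_nonneg.2 hst)]
    simp
  have hS0 : (0 : ℝ) ∈ S := ⟨⟨le_rfl, hD0⟩, by rw [h0, Realization.pathEDist_self]; simp⟩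
  have hbdd : BddAbove S := ⟨D, fun s hs => hs.1.2⟩
  have hσ : sSup S ∈ Set.Icc 0 D := ⟨le_csSup hbdd hS0, csSup_le ⟨0, hS0⟩ fun s hs => hs.1.2⟩
  obtain ⟨ε, hε, hloc⟩ := hV.exists_pos_inCommonSimplex (α (sSup S))
  have hσS : sSup S ∈ S := by
    obtain ⟨s, hs, hlt⟩ := exists_lt_of_lt_csSup ⟨0, hS0⟩ (sub_lt_self (sSup S) hε)
    have hle := le_csSup hbdd hs
    refine hstep s hs _ hσ hle ?_
    obtain ⟨σ, h, h', h''⟩ := hloc (α s) (by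
      rw [hα _ hσ _ hs.1, abs_of_nonneg (by linarith)]
      linarith)
    exact ⟨σ, h, h'', h'⟩
  have hσD : sSup S = D := by
    by_contra hne
    have hlt : sSup S < D := lt_of_le_of_ne hσ.2 hne
    have hm : sSup S < min D (sSup S + ε / 2) := lt_min hlt (by linarith)
    have hmS : min D (sSup S + ε / 2) ∈ Set.Icc 0 D := ⟨hσ.1.trans hm.le, min_le_left _ _⟩
    refine absurd (le_csSup hbdd (hstep _ hσS _ hmS hm.le (hloc _ ?_))) (not_le.2 hm)
    rw [hα _ hσ _ hmS, abs_sub_comm, abs_of_nonneg (by linarith)]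
    linarith [min_le_right D (sSup S + ε / 2)]
  have := hσS.2
  rwa [hσD, h1, hD, ← edist_dist] at this

theorem isSimplicialTree (hV : IsVertexSet V) (h4 : FourPoint Y) (hg : IsGeodesicSpace Y) :
    IsSimplicialTree Y := by
  refine ⟨isRealTree_of_fourPoint h4 hg, V, unitGraph V, Equiv.ofBijective hV.toRealization
    ⟨hV.toRealization_injective h4, hV.toRealization_surjective hg⟩, fun y z => ?_⟩
  refine le_antisymm ?_ (hV.pathEDist_toRealization_le h4 hg y z)
  refine le_iInf fun n => le_iInf fun p => le_iInf fun h0 => le_iInf fun hn => le_iInf fun hp => ?_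
  choose q hq using fun i => hV.toRealization_surjective hg (p i)
  have hy : q 0 = y := hV.toRealization_injective h4 ((hq 0).trans h0)
  have hz : q n = z := hV.toRealization_injective h4 ((hq n).trans hn)
  rw [← hy, ← hz]
  refine (edist_le_range_sum_edist q n).trans (Finset.sum_le_sum fun i hi => ?_)
  have := hp i (Finset.mem_range.1 hi)
  rw [← hq, ← hq] at this ⊢
  rw [hV.simplexDist_toRealization h4 this, edist_dist]

end IsVertexSet

/-- The combinatorial data of a rooted tree: each index `i` gives a ray of length `level i` from
the root, and the rays of `i` and `j` share their initial segments of length `meet i j`. -/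
structure RootedTreeData (I : Type u) where
  level : I → ℕ
  meet : I → I → ℕ
  meet_self : ∀ i, meet i i = level i
  meet_comm : ∀ i j, meet i j = meet j i
  min_meet_le : ∀ i j k, min (meet i j) (meet j k) ≤ meet i k

namespace RootedTreeData

variable {I : Type u} (T : RootedTreeData I)

theorem meet_le_left (i j : I) : T.meet i j ≤ T.level i := by
  have := T.min_meet_le i j i
  rwa [T.meet_comm j i, min_self, T.meet_self] at this

/-- Points of the rays, before the identification of common segments. -/
structure RayPoint where
  ray : I
  height : ℝ
  nonneg : 0 ≤ height
  le_level : height ≤ T.level ray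

variable {T}

namespace RayPoint

/-- The Gromov product of two points, based at the root. -/
noncomputable def product (p q : T.RayPoint) : ℝ :=
  min (min p.height q.height) (T.meet p.ray q.ray)

theorem product_self (p : T.RayPoint) : p.product p = p.height := by
  simp [product, T.meet_self, p.le_level]

theorem product_comm (p q : T.RayPoint) : p.product q = q.product p := by
  rw [product, product, min_comm p.height, T.meet_comm]

theorem product_le_left (p q : T.RayPoint) : p.product q ≤ p.height :=
  (min_le_left _ _).trans (min_le_left _ _)

theorem product_le_right (p q : T.RayPoint) : p.product q ≤ q.height :=
  (min_le_left _ _).trans (min_le_right _ _)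

theorem min_product_le (p q r : T.RayPoint) : min (p.product q) (q.product r) ≤ p.product r := by
  have h : min (T.meet p.ray q.ray : ℝ) (T.meet q.ray r.ray) ≤ T.meet p.ray r.ray := by
    exact_mod_cast T.min_meet_le p.ray q.ray r.ray
  simp only [product]
  refine le_min (le_min ?_ ?_) (le_trans (min_le_min (min_le_right _ _) (min_le_right _ _)) h)
  · exact (min_le_left _ _).trans ((min_le_left _ _).trans (min_le_left _ _))
  · exact (min_le_right _ _).trans ((min_le_left _ _).trans (min_le_right _ _))

noncomputable instance : PseudoMetricSpace T.RayPoint where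
  dist p q := p.height + q.height - 2 * p.product q
  dist_self p := by rw [product_self]; ring
  dist_comm p q := by rw [product_comm]; ring
  dist_triangle p q r := by
    have h := min_product_le p q r
    have h1 := product_le_right p q
    have h2 := product_le_left q r
    rcases min_le_iff.1 h with h | h <;> linarith

theorem dist_def (p q : T.RayPoint) : dist p q = p.height + q.height - 2 * p.product q := rfl

theorem fourPoint : FourPoint T.RayPoint := by
  intro x y z w
  simp only [dist_def]
  have h1 := min_product_le x y z
  have h2 := min_product_le x z y
  have h3 := min_product_le y x z
  have h4 := min_product_le x y w
  have h5 := min_product_le x w y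
  have h6 := min_product_le y x w
  have h7 := min_product_le x z w
  have h8 := min_product_le x w z
  have h9 := min_product_le z x w
  have h10 := min_product_le y z w
  have h11 := min_product_le y w z
  have h12 := min_product_le z y w
  have e1 := product_comm y x
  have e2 := product_comm z x
  have e3 := product_comm z y
  have e4 := product_comm w x
  have e5 := product_comm w y
  have e6 := product_comm w z
  simp only [min_le_iff] at *
  rw [le_max_iff]
  by_contra! hcon
  grind

theorem dist_of_ray_eq {p q : T.RayPoint} (h : p.ray = q.ray) :
    dist p q = |p.height - q.height| := by
  have hp := p.le_level
  have hq := q.le_level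
  rw [dist_def, product, h, T.meet_self, ← h]
  rcases le_total p.height q.height with hpq | hpq
  · rw [min_eq_left hpq, min_eq_left hp, abs_of_nonpos (by linarith)]
    ring
  · rw [h, min_eq_right hpq, min_eq_left hq, abs_of_nonneg (by linarith)]
    ring

/-- The point at height `t` on the ray of `p`. -/
noncomputable def truncate (p : T.RayPoint) (t : ℝ) : T.RayPoint :=
  ⟨p.ray, max 0 (min t (T.level p.ray)), le_max_left _ _,
    max_le (Nat.cast_nonneg _) (min_le_right _ _)⟩

theorem height_truncate (p : T.RayPoint) {t : ℝ} (h0 : 0 ≤ t) (h : t ≤ p.height) :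
    (p.truncate t).height = t := by
  change max 0 (min t (T.level p.ray : ℝ)) = t
  rw [min_eq_left (h.trans p.le_level), max_eq_right h0]

theorem dist_truncate_truncate (p : T.RayPoint) {s t : ℝ} (hs0 : 0 ≤ s) (hs : s ≤ p.height)
    (ht0 : 0 ≤ t) (ht : t ≤ p.height) : dist (p.truncate s) (p.truncate t) = |s - t| := by
  rw [dist_of_ray_eq (p := p.truncate s) (q := p.truncate t) rfl, height_truncate p hs0 hs, height_truncate p ht0 ht]

theorem dist_truncate_self (p : T.RayPoint) {t : ℝ} (h0 : 0 ≤ t) (h : t ≤ p.height) :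
    dist (p.truncate t) p = p.height - t := by
  rw [dist_of_ray_eq (p := p.truncate t) (q := p) rfl, height_truncate p h0 h, abs_sub_comm, abs_of_nonneg (by linarith)]

theorem dist_truncate_truncate_of_product_le (p q : T.RayPoint) {s t : ℝ}
    (hs0 : p.product q ≤ s) (hs : s ≤ p.height) (ht0 : p.product q ≤ t) (ht : t ≤ q.height) :
    dist (p.truncate s) (q.truncate t) = s + t - 2 * p.product q := by
  have hm0 : 0 ≤ p.product q := le_min (le_min p.nonneg q.nonneg) (Nat.cast_nonneg _)
  have hmN : p.product q ≤ T.meet p.ray q.ray := min_le_right _ _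
  rw [dist_def, product, height_truncate p (hm0.trans hs0) hs,
    height_truncate q (hm0.trans ht0) ht]
  congr 2
  exact le_antisymm (min_le_min (min_le_min hs ht) le_rfl) (le_min (le_min hs0 ht0) hmN)

theorem exists_geodesic (p q : T.RayPoint) :
    ∃ α : ℝ → T.RayPoint, dist (α 0) p = 0 ∧ dist (α (dist p q)) q = 0 ∧
      ∀ s ∈ Set.Icc 0 (dist p q), ∀ t ∈ Set.Icc 0 (dist p q), dist (α s) (α t) = |s - t| := by
  have hmp := product_le_left p q
  have hmq := product_le_right p q
  have hm0 : 0 ≤ p.product q := le_min (le_min p.nonneg q.nonneg) (Nat.cast_nonneg _)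
  have hD := dist_def p q
  set m := p.product q with hm
  let α : ℝ → T.RayPoint := fun s =>
    if s ≤ p.height - m then p.truncate (p.height - s) else q.truncate (s - p.height + 2 * m)
  have hα1 : ∀ s, s ≤ p.height - m → α s = p.truncate (p.height - s) := fun s hs => if_pos hs
  have hα2 : ∀ s, p.height - m < s → α s = q.truncate (s - p.height + 2 * m) :=
    fun s hs => if_neg (not_le.2 hs)
  have hmix : ∀ s t, 0 ≤ s → s ≤ p.height - m → p.height - m < t → t ≤ dist p q →
      dist (α s) (α t) = t - s := by
    intro s t hs0 hs ht ht1
    rw [hα1 s hs, hα2 t ht, dist_truncate_truncate_of_product_le] <;> linarith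
  refine ⟨α, ?_, ?_, ?_⟩
  · rw [hα1 0 (by linarith), dist_truncate_self] <;> linarith
  · rcases hmq.eq_or_lt with h | h
    · have e : dist p q = p.height - m := by linarith
      rw [e, hα1 _ le_rfl, ← dist_comm]
      have e2 : dist (q.truncate q.height) q = 0 := by
        rw [dist_truncate_self] <;> linarith
      have e3 := dist_truncate_truncate_of_product_le p q (s := p.height - (p.height - m))
        (t := q.height) (by linarith) (by linarith) (by linarith) le_rfl
      have := dist_triangle (p.truncate (p.height - (p.height - m))) (q.truncate q.height) q
      rw [dist_comm]
      exact le_antisymm (by linarith) dist_nonneg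
    · rw [hα2 _ (by linarith), dist_truncate_self] <;> linarith
  · rintro s ⟨hs0, hs1⟩ t ⟨ht0, ht1⟩
    rcases le_or_gt s (p.height - m) with hs | hs <;> rcases le_or_gt t (p.height - m) with ht | ht
    · rw [hα1 s hs, hα1 t ht, dist_truncate_truncate p, abs_sub_comm]
      · congr 1
        ring
      all_goals linarith
    · rw [hmix s t hs0 hs ht ht1, abs_sub_comm, abs_of_nonneg (by linarith)]
    · rw [dist_comm, hmix t s ht0 ht hs hs1, abs_of_nonneg (by linarith)]
    · rw [hα2 s hs, hα2 t ht, dist_truncate_truncate q]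
      · congr 1
        ring
      all_goals linarith

theorem exists_vertices (p : T.RayPoint) :
    ∃ a b : T.RayPoint, (∃ n : ℕ, a.height = n) ∧ (∃ n : ℕ, b.height = n) ∧
      (dist a b = 0 ∨ dist a b = 1) ∧ dist a p + dist p b = dist a b ∧
      ∀ v : T.RayPoint, (∃ n : ℕ, v.height = n) → dist p v < 1 → dist v a = 0 ∨ dist v b = 0 := by
  have h0 := p.nonneg
  have hfl : (⌊p.height⌋₊ : ℝ) ≤ p.height := Nat.floor_le h0
  have hce : p.height ≤ ⌈p.height⌉₊ := Nat.le_ceil _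
  have hceL : ⌈p.height⌉₊ ≤ T.level p.ray := Nat.ceil_le.2 p.le_level
  let a : T.RayPoint := ⟨p.ray, ⌊p.height⌋₊, Nat.cast_nonneg _, hfl.trans p.le_level⟩
  let b : T.RayPoint := ⟨p.ray, ⌈p.height⌉₊, Nat.cast_nonneg _, by exact_mod_cast hceL⟩
  have hab : dist a b = ⌈p.height⌉₊ - ⌊p.height⌋₊ := by
    rw [dist_of_ray_eq (p := a) (q := b) rfl, abs_sub_comm, abs_of_nonneg (sub_nonneg.2 (hfl.trans hce))]
  refine ⟨a, b, ⟨_, rfl⟩, ⟨_, rfl⟩, ?_, ?_, ?_⟩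
  · have h1 := Nat.ceil_le_floor_add_one p.height
    have h2 := Nat.floor_le_ceil p.height
    rw [hab]
    rcases Nat.le_and_le_add_one_iff.1 ⟨h2, h1⟩ with h | h <;> rw [h] <;> simp
  · rw [hab, dist_of_ray_eq (p := a) (q := p) rfl, dist_of_ray_eq (p := p) (q := b) rfl, abs_sub_comm,
      abs_of_nonneg (sub_nonneg.2 hfl), abs_sub_comm, abs_of_nonneg (sub_nonneg.2 hce)]
    ring
  · rintro ⟨j, _, hv0, hvL⟩ ⟨n, rfl⟩ hlt
    rw [dist_def] at hlt
    simp only [product] at hlt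
    rcases le_total (min p.height (n : ℝ)) (T.meet p.ray j : ℝ) with hN | hN
    · rw [min_eq_left hN] at hlt
      rcases le_total p.height n with hn | hn
      · rw [min_eq_left hn] at hlt hN
        have e : ⌈p.height⌉₊ = n := by
          refine le_antisymm (Nat.ceil_le.2 hn) ?_
          have : (n : ℝ) < ⌈p.height⌉₊ + 1 := by linarith
          exact Nat.lt_succ_iff.1 (by exact_mod_cast this)
        have hN' := Nat.ceil_le.2 hN
        right
        rw [dist_def]
        simp only [product, b]
        rw [e, min_self, T.meet_comm, min_eq_left (by rw [← e]; exact_mod_cast hN')]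
        ring
      · rw [min_eq_right hn] at hlt hN
        have e : ⌊p.height⌋₊ = n := by
          rw [Nat.floor_eq_iff h0]
          exact ⟨hn, by linarith⟩
        left
        rw [dist_def]
        simp only [product, a]
        rw [e, min_self, T.meet_comm, min_eq_left hN]
        ring
    · rw [min_eq_right hN] at hlt
      have h1 := hN.trans (min_le_left _ _)
      have h2 := hN.trans (min_le_right _ _)
      rcases h2.eq_or_lt with h | h
      · have e : ⌊p.height⌋₊ = n := by
          rw [Nat.floor_eq_iff h0]
          exact ⟨by linarith, by linarith⟩
        left
        rw [dist_def]
        simp only [product, a]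
        rw [e, min_self, T.meet_comm, h, min_self]
        ring
      · have h : T.meet p.ray j + 1 ≤ n := by exact_mod_cast h
        have h : (T.meet p.ray j : ℝ) + 1 ≤ n := by exact_mod_cast h
        linarith

end RayPoint

variable (T) in
/-- The tree obtained by gluing the rays along their common initial segments. -/
abbrev Tree : Type u := SeparationQuotient T.RayPoint

variable (T) in
/-- The end of the ray of `i`. -/
noncomputable def tip (i : I) : T.Tree :=
  SeparationQuotient.mk ⟨i, T.level i, Nat.cast_nonneg _, le_rfl⟩

namespace Tree

theorem fourPoint : FourPoint T.Tree := by
  intro x y z w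
  obtain ⟨x, rfl⟩ := SeparationQuotient.surjective_mk x
  obtain ⟨y, rfl⟩ := SeparationQuotient.surjective_mk y
  obtain ⟨z, rfl⟩ := SeparationQuotient.surjective_mk z
  obtain ⟨w, rfl⟩ := SeparationQuotient.surjective_mk w
  simp only [SeparationQuotient.dist_mk]
  exact RayPoint.fourPoint x y z w

theorem isGeodesicSpace : IsGeodesicSpace T.Tree := by
  intro x y
  obtain ⟨p, rfl⟩ := SeparationQuotient.surjective_mk x
  obtain ⟨q, rfl⟩ := SeparationQuotient.surjective_mk y
  obtain ⟨α, h0, h1, hα⟩ := RayPoint.exists_geodesic p q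
  refine ⟨fun s => SeparationQuotient.mk (α s), ?_, ?_, ?_⟩
  · rwa [← dist_eq_zero, SeparationQuotient.dist_mk]
  · rwa [← dist_eq_zero, SeparationQuotient.dist_mk, SeparationQuotient.dist_mk]
  · simpa only [SeparationQuotient.dist_mk] using hα

theorem isVertexSet :
    IsVertexSet (SeparationQuotient.mk '' {p : T.RayPoint | ∃ n : ℕ, p.height = n}) := by
  intro y
  obtain ⟨p, rfl⟩ := SeparationQuotient.surjective_mk y
  obtain ⟨a, b, ha, hb, hab, hp, hv⟩ := p.exists_vertices
  refine ⟨_, ⟨a, ha, rfl⟩, _, ⟨b, hb, rfl⟩, ?_, ?_, ?_⟩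
  · rwa [← dist_eq_zero, SeparationQuotient.dist_mk]
  · simpa only [SeparationQuotient.dist_mk] using hp
  · rintro _ ⟨v, hvn, rfl⟩ hlt
    rw [SeparationQuotient.dist_mk] at hlt
    refine (hv v hvn hlt).imp (fun h => ?_) fun h => ?_ <;>
    rwa [← dist_eq_zero, SeparationQuotient.dist_mk]

variable (T) in
theorem isSimplicialTree : IsSimplicialTree T.Tree :=
  isVertexSet.isSimplicialTree fourPoint isGeodesicSpace

theorem dist_tip_tip (i j : I) :
    dist (T.tip i) (T.tip j) = T.level i + T.level j - 2 * T.meet i j := by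
  rw [tip, tip, SeparationQuotient.dist_mk, RayPoint.dist_def, RayPoint.product]
  congr 2
  have h1 := T.meet_le_left i j
  have h2 := T.meet_le_left j i
  rw [T.meet_comm] at h2
  exact min_eq_right (le_min (Nat.cast_le.2 h1) (Nat.cast_le.2 h2))

theorem exists_dist_tip_le (h : ∀ i, ∀ n ≤ T.level i, ∃ j, T.level j = n ∧ T.meet j i = n)
    (y : T.Tree) : ∃ i, dist (T.tip i) y ≤ 1 := by
  obtain ⟨p, rfl⟩ := SeparationQuotient.surjective_mk y
  have hfl : (⌊p.height⌋₊ : ℝ) ≤ p.height := Nat.floor_le p.nonneg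
  have hlt := Nat.lt_floor_add_one p.height
  obtain ⟨j, hj, hji⟩ := h p.ray ⌊p.height⌋₊ (by exact_mod_cast hfl.trans p.le_level)
  refine ⟨j, ?_⟩
  rw [tip, SeparationQuotient.dist_mk, RayPoint.dist_def, RayPoint.product]
  simp only
  rw [hj, hji, min_eq_left hfl, min_self]
  linarith

end Tree

end RootedTreeData
namespace IsRealTree

variable {X : Type u} [MetricSpace X] (hX : IsRealTree X)

/-- The unique arc from `x` to `y`. -/
noncomputable def segment (x y : X) : Set X :=
  (hX x y).choose '' Set.Icc 0 (dist x y)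

theorem exists_geodesic (x y : X) : ∃ α : ℝ → X, α 0 = x ∧ α (dist x y) = y ∧
    (∀ s ∈ Set.Icc 0 (dist x y), ∀ t ∈ Set.Icc 0 (dist x y), dist (α s) (α t) = |s - t|) ∧
    hX.segment x y = α '' Set.Icc 0 (dist x y) :=
  let h := (hX x y).choose_spec
  ⟨_, h.1, h.2.1, h.2.2.1, rfl⟩

theorem image_eq_segment {x y : X} {r : ℝ} {β : ℝ → X} (hr : 0 ≤ r)
    (hc : ContinuousOn β (Set.Icc 0 r)) (hi : Set.InjOn β (Set.Icc 0 r))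
    (h0 : β 0 = x) (h1 : β r = y) : β '' Set.Icc 0 r = hX.segment x y := by
  refine (hX x y).choose_spec.2.2.2 r β hr ?_ h0 h1
  exact ((continuousOn_iff_continuous_domRestrict.1 hc).isClosedEmbedding
    (Set.injOn_iff_injective.1 hi)).isEmbedding

theorem segment_comm (x y : X) : hX.segment x y = hX.segment y x := by
  obtain ⟨α, h0, h1, hα, hs⟩ := hX.exists_geodesic x y
  have hmap : ∀ t ∈ Set.Icc 0 (dist x y), dist x y - t ∈ Set.Icc 0 (dist x y) := fun t ht =>
    ⟨by linarith [ht.2], by linarith [ht.1]⟩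
  have hd : ∀ s ∈ Set.Icc 0 (dist x y), ∀ t ∈ Set.Icc 0 (dist x y),
      dist (α (dist x y - s)) (α (dist x y - t)) = |s - t| := fun s hs t ht => by
    rw [hα _ (hmap s hs) _ (hmap t ht), abs_sub_comm]
    congr 1
    ring
  rw [← hX.image_eq_segment (x := y) (y := x) (β := fun t => α (dist x y - t)) (r := dist x y)
    dist_nonneg ?_ ?_ (by simpa using h1) (by simpa using h0), hs]
  · ext m
    constructor
    · rintro ⟨t, ht, rfl⟩
      exact ⟨_, hmap t ht, by simp⟩
    · rintro ⟨t, ht, rfl⟩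
      exact ⟨_, hmap t ht, rfl⟩
  · exact (LipschitzOnWith.of_dist_le_mul (K := 1) fun s hs t ht => by
      rw [NNReal.coe_one, one_mul]; exact (hd s hs t ht).le).continuousOn
  · intro s hs t ht h
    have := hd s hs t ht
    simp only at h
    rw [h, dist_self] at this
    linarith [abs_eq_zero.1 this.symm]

theorem exists_mem_segment {x y : X} {t : ℝ} (ht : t ∈ Set.Icc 0 (dist x y)) :
    ∃ m ∈ hX.segment x y, dist x m = t ∧ dist m y = dist x y - t := by
  obtain ⟨α, h0, h1, hα, hs⟩ := hX.exists_geodesic x y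
  refine ⟨α t, hs ▸ ⟨t, ht, rfl⟩, ?_, ?_⟩
  · have := hα 0 ⟨le_rfl, dist_nonneg⟩ t ht
    rwa [h0, zero_sub, abs_neg, abs_of_nonneg ht.1] at this
  · have := hα t ht _ ⟨dist_nonneg, le_rfl⟩
    rwa [h1, abs_sub_comm, abs_of_nonneg (sub_nonneg.2 ht.2)] at this

theorem dist_add_dist_of_mem_segment {x y m : X} (hm : m ∈ hX.segment x y) :
    dist x m + dist m y = dist x y := by
  obtain ⟨α, h0, h1, hα, hs⟩ := hX.exists_geodesic x y
  rw [hs] at hm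
  obtain ⟨t, ht, rfl⟩ := hm
  have e1 := hα 0 ⟨le_rfl, dist_nonneg⟩ t ht
  have e2 := hα t ht _ ⟨dist_nonneg, le_rfl⟩
  rw [h0, zero_sub, abs_neg, abs_of_nonneg ht.1] at e1
  rw [h1, abs_sub_comm, abs_of_nonneg (sub_nonneg.2 ht.2)] at e2
  rw [e1, e2]
  ring

theorem segment_subset_union (x y z : X) :
    hX.segment x z ⊆ hX.segment x y ∪ hX.segment y z := by
  obtain ⟨α, α0, α1, hα, hαs⟩ := hX.exists_geodesic x y
  obtain ⟨β, β0, β1, hβ, hβs⟩ := hX.exists_geodesic y z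
  set d := dist x y with hd
  set e := dist y z with he
  have hd0 : 0 ≤ d := dist_nonneg
  have he0 : 0 ≤ e := dist_nonneg
  have hcα : ContinuousOn α (Set.Icc 0 d) :=
    (LipschitzOnWith.of_dist_le_mul (K := 1) fun s hs t ht => by
      rw [NNReal.coe_one, one_mul]; exact (hα s hs t ht).le).continuousOn
  have hcβ : ContinuousOn β (Set.Icc 0 e) :=
    (LipschitzOnWith.of_dist_le_mul (K := 1) fun s hs t ht => by
      rw [NNReal.coe_one, one_mul]; exact (hβ s hs t ht).le).continuousOn
  have hiα : Set.InjOn α (Set.Icc 0 d) := fun s hs t ht h => by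
    have := hα s hs t ht
    rw [h, dist_self] at this
    linarith [abs_eq_zero.1 this.symm]
  have hiβ : Set.InjOn β (Set.Icc 0 e) := fun s hs t ht h => by
    have := hβ s hs t ht
    rw [h, dist_self] at this
    linarith [abs_eq_zero.1 this.symm]
  have hcl : IsClosed (β '' Set.Icc 0 e) := (isCompact_Icc.image_of_continuousOn hcβ).isClosed
  have hS : IsCompact (Set.Icc 0 d ∩ α ⁻¹' (β '' Set.Icc 0 e)) :=
    isCompact_Icc.of_isClosed_subset (hcα.preimage_isClosed_of_isClosed isClosed_Icc hcl)
      Set.inter_subset_left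
  obtain ⟨s₀, ⟨⟨hs0, hs1⟩, t₀, ⟨ht0, ht1⟩, hst⟩, hmin⟩ := hS.exists_isLeast
    ⟨d, ⟨hd0, le_rfl⟩, 0, ⟨le_rfl, he0⟩, by rw [β0, α1]⟩
  let γ : ℝ → X := fun r => if r ≤ s₀ then α r else β (r - s₀ + t₀)
  have hγ1 : ∀ r, r ≤ s₀ → γ r = α r := fun r hr => if_pos hr
  have hγ2 : ∀ r, s₀ ≤ r → γ r = β (r - s₀ + t₀) := by
    intro r hr
    rcases hr.eq_or_lt with rfl | hr
    · rw [hγ1 _ le_rfl, sub_self, zero_add, hst]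
    · exact if_neg (not_le.2 hr)
  have hunion : Set.Icc 0 (s₀ + (e - t₀)) = Set.Icc 0 s₀ ∪ Set.Icc s₀ (s₀ + (e - t₀)) :=
    (Set.Icc_union_Icc_eq_Icc hs0 (by linarith)).symm
  have hmap : ∀ r ∈ Set.Icc s₀ (s₀ + (e - t₀)), r - s₀ + t₀ ∈ Set.Icc 0 e := fun r hr =>
    ⟨by linarith [hr.1], by linarith [hr.2]⟩
  have hc : ContinuousOn γ (Set.Icc 0 (s₀ + (e - t₀))) := by
    rw [hunion]
    refine ContinuousOn.union_of_isClosed ?_ ?_ isClosed_Icc isClosed_Icc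
    · exact (hcα.mono (Set.Icc_subset_Icc_right hs1)).congr fun r hr => hγ1 r hr.2
    · exact (hcβ.comp (f := fun r => r - s₀ + t₀) (by fun_prop) hmap).congr
        fun r hr => hγ2 r hr.1
  have hmix : ∀ a b, 0 ≤ a → a ≤ s₀ → s₀ ≤ b → b ≤ s₀ + (e - t₀) → γ a = γ b → a = b := by
    intro a b ha0 ha hb hb1 h
    rw [hγ1 a ha, hγ2 b hb] at h
    have h1 : s₀ ≤ a := hmin ⟨⟨ha0, ha.trans hs1⟩, _, hmap b ⟨hb, hb1⟩, h.symm⟩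
    obtain rfl : a = s₀ := le_antisymm ha h1
    rw [← hst] at h
    have := hiβ ⟨ht0, ht1⟩ (hmap b ⟨hb, hb1⟩) h
    linarith
  have hi : Set.InjOn γ (Set.Icc 0 (s₀ + (e - t₀))) := by
    rintro a ⟨ha0, ha1⟩ b ⟨hb0, hb1⟩ h
    rcases le_total a s₀ with ha | ha <;> rcases le_total b s₀ with hb | hb
    · rw [hγ1 a ha, hγ1 b hb] at h
      exact hiα ⟨ha0, ha.trans hs1⟩ ⟨hb0, hb.trans hs1⟩ h
    · exact hmix a b ha0 ha hb hb1 h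
    · exact (hmix b a hb0 hb ha ha1 h.symm).symm
    · rw [hγ2 a ha, hγ2 b hb] at h
      have := hiβ (hmap a ⟨ha, ha1⟩) (hmap b ⟨hb, hb1⟩) h
      linarith
  rw [← hX.image_eq_segment (β := γ) (by linarith) hc hi
    ((hγ1 0 hs0).trans α0) ((hγ2 _ (by linarith)).trans (by rw [← β1]; congr 1; ring)), hunion,
    hαs, hβs]
  rintro _ ⟨r, hr | hr, rfl⟩
  · exact Or.inl ⟨r, ⟨hr.1, hr.2.trans hs1⟩, (hγ1 r hr.2).symm⟩
  · exact Or.inr ⟨_, hmap r hr, (hγ2 r hr.1).symm⟩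

end IsRealTree

section Graph

variable {V : Type v} {Z : SimpleGraph V}

theorem exists_adj_dist_add_one (hZ : Z.Connected) {u v : V} (h : u ≠ v) :
    ∃ u', Z.Adj u u' ∧ Z.dist u' v + 1 = Z.dist u v := by
  obtain ⟨p, hp⟩ := hZ.exists_walk_length_eq_dist u v
  cases p with
  | nil => exact absurd rfl h
  | @cons _ u' _ hadj q =>
    refine ⟨u', hadj, ?_⟩
    rw [SimpleGraph.Walk.length_cons] at hp
    have h1 := SimpleGraph.dist_le q
    have h2 := hZ.dist_triangle (u := u) (v := u') (w := v)
    have h3 := SimpleGraph.dist_eq_one_iff_adj.2 hadj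
    omega

/-- `u` and `v` are joined by a path in the graph which stays at distance at least `n`
from `w`. -/
def Linked (Z : SimpleGraph V) (w : V) (n : ℕ) (u v : V) : Prop :=
  n ≤ Z.dist w u ∧
    Relation.ReflTransGen (fun a b => Z.Adj a b ∧ n ≤ Z.dist w a ∧ n ≤ Z.dist w b) u v

namespace Linked

variable {w : V} {n : ℕ} {u v x : V}

theorem refl (h : n ≤ Z.dist w u) : Linked Z w n u u := ⟨h, .refl⟩

theorem single (h : Z.Adj u v) (hu : n ≤ Z.dist w u) (hv : n ≤ Z.dist w v) : Linked Z w n u v :=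
  ⟨hu, .single ⟨h, hu, hv⟩⟩

theorem le_left (h : Linked Z w n u v) : n ≤ Z.dist w u := h.1

theorem le_right (h : Linked Z w n u v) : n ≤ Z.dist w v := by
  rcases Relation.ReflTransGen.cases_tail h.2 with h' | ⟨_, _, h'⟩
  · exact h' ▸ h.1
  · exact h'.2.2

theorem symm (h : Linked Z w n u v) : Linked Z w n v u :=
  have : Std.Symm fun a b => Z.Adj a b ∧ n ≤ Z.dist w a ∧ n ≤ Z.dist w b :=
    ⟨fun _ _ h => ⟨h.1.symm, h.2.2, h.2.1⟩⟩
  ⟨h.le_right, Std.Symm.symm _ _ h.2⟩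

theorem trans (h : Linked Z w n u v) (h' : Linked Z w n v x) : Linked Z w n u x :=
  ⟨h.1, h.2.trans h'.2⟩

theorem mono {m : ℕ} (hmn : m ≤ n) (h : Linked Z w n u v) : Linked Z w m u v :=
  ⟨hmn.trans h.1, Relation.ReflTransGen.mono
    (fun _ _ h => ⟨h.1, hmn.trans h.2.1, hmn.trans h.2.2⟩) _ _ h.2⟩

end Linked

theorem exists_linked_dist_eq (hZ : Z.Connected) (w : V) {n : ℕ} {v : V} (hn : n ≤ Z.dist w v) :
    ∃ x, Z.dist w x = n ∧ Linked Z w n x v ∧ Z.dist x v + n ≤ Z.dist w v := by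
  induction hk : Z.dist w v - n generalizing v with
  | zero =>
    have : Z.dist w v = n := by omega
    exact ⟨v, this, .refl hn, by rw [SimpleGraph.dist_self]; omega⟩
  | succ k ih =>
    have hne : v ≠ w := by
      rintro rfl
      rw [SimpleGraph.dist_self] at hk
      omega
    obtain ⟨v', hadj, hd⟩ := exists_adj_dist_add_one hZ hne
    rw [SimpleGraph.dist_comm, SimpleGraph.dist_comm (u := v)] at hd
    obtain ⟨x, hx, hl, hxd⟩ := ih (v := v') (by omega) (by omega)
    refine ⟨x, hx, hl.trans (.single hadj.symm (by omega) hn), ?_⟩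
    have h1 := hZ.dist_triangle (u := x) (v := v') (w := v)
    have h2 := SimpleGraph.dist_eq_one_iff_adj.2 hadj.symm
    omega

theorem linked_of_two_mul_add_dist_le (hZ : Z.Connected) (w : V) {n : ℕ} {u v : V}
    (h : 2 * n + Z.dist u v ≤ Z.dist w u + Z.dist w v) : Linked Z w n u v := by
  induction hk : Z.dist u v generalizing u with
  | zero =>
    obtain rfl := hZ.dist_eq_zero_iff.1 hk
    exact .refl (by omega)
  | succ k ih =>
    have hne : u ≠ v := by
      rintro rfl
      rw [SimpleGraph.dist_self] at hk
      omega
    obtain ⟨u', hadj, hd⟩ := exists_adj_dist_add_one hZ hne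
    have h1 := hZ.dist_triangle (u := w) (v := u') (w := u)
    have h2 := SimpleGraph.dist_eq_one_iff_adj.2 hadj.symm
    have h3 := hZ.dist_triangle (u := w) (v := u) (w := v)
    have hl := ih (u := u') (by omega) (by omega)
    exact (Linked.single hadj (by omega) hl.le_left).trans hl

open Classical in
/-- The rooted tree of components of complements of balls around `w`. -/
noncomputable def componentTree (Z : SimpleGraph V) (w : V) : RootedTreeData V :=
  have key : ∀ u v n, n ≤ Nat.findGreatest (fun n => Linked Z w n u v) (Z.dist w u) ↔
      n = 0 ∨ Linked Z w n u v := by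
    intro u v n
    constructor
    · intro h
      rcases Nat.eq_zero_or_pos n with h0 | h0
      · exact Or.inl h0
      · exact Or.inr ((Nat.findGreatest_of_ne_zero (m := Nat.findGreatest
          (fun n => Linked Z w n u v) (Z.dist w u)) rfl (by omega)).mono h)
    · rintro (rfl | h)
      · exact Nat.zero_le _
      · exact Nat.le_findGreatest h.le_left h
  { level := Z.dist w
    meet := fun u v => Nat.findGreatest (fun n => Linked Z w n u v) (Z.dist w u)
    meet_self := fun u =>
      le_antisymm (Nat.findGreatest_le _) (Nat.le_findGreatest le_rfl (.refl le_rfl))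
    meet_comm := fun u v => eq_of_forall_le_iff fun n => by
      rw [key, key]
      exact or_congr_right ⟨.symm, .symm⟩
    min_meet_le := fun u v x => by
      rw [key]
      have h1 := (key u v _).1 (min_le_left _ (Nat.findGreatest (fun n => Linked Z w n v x)
        (Z.dist w v)))
      have h2 := (key v x _).1 (min_le_right (Nat.findGreatest (fun n => Linked Z w n u v)
        (Z.dist w u)) _)
      rcases h1 with h1 | h1
      · exact Or.inl h1
      rcases h2 with h2 | h2
      · exact Or.inl h2
      exact Or.inr (h1.trans h2) }

theorem level_componentTree (Z : SimpleGraph V) (w v : V) :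
    (componentTree Z w).level v = Z.dist w v := rfl

theorem le_meet_of_linked {w u v : V} {n : ℕ} (h : Linked Z w n u v) :
    n ≤ (componentTree Z w).meet u v := by
  classical
  exact Nat.le_findGreatest h.le_left h

theorem linked_meet (hZ : Z.Connected) (w u v : V) :
    Linked Z w ((componentTree Z w).meet u v) u v := by
  classical
  exact Nat.findGreatest_spec (P := fun n => Linked Z w n u v) (Nat.zero_le _)
    (linked_of_two_mul_add_dist_le hZ w (by
      have := hZ.dist_triangle (u := u) (v := w) (w := v)
      rw [SimpleGraph.dist_comm (u := u) (v := w)] at this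
      omega))

theorem exists_level_eq_and_meet_eq (hZ : Z.Connected) (w v : V) {n : ℕ}
    (hn : n ≤ (componentTree Z w).level v) :
    ∃ x, (componentTree Z w).level x = n ∧ (componentTree Z w).meet x v = n := by
  obtain ⟨x, hx, hl, -⟩ := exists_linked_dist_eq hZ w hn
  refine ⟨x, hx, le_antisymm ?_ (le_meet_of_linked hl)⟩
  rw [← hx]
  exact (componentTree Z w).meet_le_left x v

/-! ### Graphs which are coarsely embedded in a real tree -/

variable {X : Type u} [MetricSpace X] {f : V → X} {M c : ℝ}

theorem dist_map_le_mul (hZ : Z.Connected) (hf : ∀ a b, Z.Adj a b → dist (f a) (f b) ≤ M)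
    (u v : V) : dist (f u) (f v) ≤ M * Z.dist u v := by
  obtain ⟨p, hp⟩ := hZ.exists_walk_length_eq_dist u v
  rw [← hp]
  clear hp
  induction p with
  | nil => simp
  | cons h p ih =>
    rw [SimpleGraph.Walk.length_cons]
    push_cast
    linarith [hf _ _ h, dist_triangle (f _) (f _) (f _) |>.trans (add_le_add (hf _ _ h) ih)]

theorem exists_dist_le_of_linked (hX : IsRealTree X) (hM : 0 ≤ M)
    (hf : ∀ a b, Z.Adj a b → dist (f a) (f b) ≤ M) {w u v : V} {n : ℕ} (h : Linked Z w n u v)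
    {m : X} (hm : m ∈ hX.segment (f u) (f v)) : ∃ a, n ≤ Z.dist w a ∧ dist (f a) m ≤ M := by
  obtain ⟨hu, h⟩ := h
  induction h with
  | refl =>
    have := hX.dist_add_dist_of_mem_segment hm
    rw [dist_self] at this
    exact ⟨u, hu, by linarith [@dist_nonneg _ _ m (f u)]⟩
  | @tail a b _ hab ih =>
    rcases hX.segment_subset_union _ (f a) _ hm with hm | hm
    · exact ih hm
    · have := hX.dist_add_dist_of_mem_segment hm
      exact ⟨a, hab.2.1, by linarith [hf a b hab.1, @dist_nonneg _ _ m (f b)]⟩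

theorem exists_dist_le_of_mem_segment (hX : IsRealTree X) (hZ : Z.Connected) (hM : 0 ≤ M)
    (hf : ∀ a b, Z.Adj a b → dist (f a) (f b) ≤ M) {w u : V}
    {m : X} (hm : m ∈ hX.segment (f u) (f w)) :
    ∃ b, Z.dist w b + Z.dist b u ≤ Z.dist w u ∧ dist (f b) m ≤ M := by
  induction hk : Z.dist u w generalizing u with
  | zero =>
    obtain rfl := hZ.dist_eq_zero_iff.1 hk
    have := hX.dist_add_dist_of_mem_segment hm
    rw [dist_self] at this
    exact ⟨u, by simp, by linarith [@dist_nonneg _ _ m (f u)]⟩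
  | succ k ih =>
    have hne : u ≠ w := by
      rintro rfl
      rw [SimpleGraph.dist_self] at hk
      omega
    obtain ⟨u', hadj, hd⟩ := exists_adj_dist_add_one hZ hne
    rcases hX.segment_subset_union _ (f u') _ hm with hm | hm
    · have := hX.dist_add_dist_of_mem_segment hm
      exact ⟨u, by simp, by linarith [hf _ _ hadj, @dist_nonneg _ _ m (f u')]⟩
    · obtain ⟨b, hb, hbm⟩ := ih hm (by omega)
      refine ⟨b, ?_, hbm⟩
      have h1 := hZ.dist_triangle (u := b) (v := u') (w := u)
      have h2 := SimpleGraph.dist_eq_one_iff_adj.2 hadj.symm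
      rw [SimpleGraph.dist_comm, SimpleGraph.dist_comm (u := u)] at hd
      omega

theorem dist_le_of_linked_of_dist_eq (hX : IsRealTree X) (hZ : Z.Connected) (hM : 0 ≤ M)
    (hf : ∀ a b, Z.Adj a b → dist (f a) (f b) ≤ M)
    (hf' : ∀ a b, (Z.dist a b : ℝ) ≤ dist (f a) (f b) + c) {w u v : V} {n : ℕ}
    (hu : Z.dist w u = n) (hv : Z.dist w v = n) (h : Linked Z w n u v) :
    (Z.dist u v : ℝ) ≤ 2 * (M * (2 * M + c) + M) + c := by
  have hd : 0 ≤ dist (f u) (f v) := dist_nonneg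
  obtain ⟨m, hm, hum, hmv⟩ := hX.exists_mem_segment (x := f u) (y := f v)
    (t := dist (f u) (f v) / 2) ⟨by linarith, by linarith⟩
  obtain ⟨a, ha, ham⟩ := exists_dist_le_of_linked hX hM hf h hm
  have key : ∀ x, Z.dist w x = n → dist (f x) m = dist (f u) (f v) / 2 →
      (∃ b, Z.dist w b + Z.dist b x ≤ Z.dist w x ∧ dist (f b) m ≤ M) →
      (Z.dist u v : ℝ) ≤ 2 * (M * (2 * M + c) + M) + c := by
    rintro x hx hxm ⟨b, hb, hbm⟩
    have h1 := hf' a b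
    have h2 := dist_triangle_right (f a) (f b) m
    have h3 := hZ.dist_triangle (u := w) (v := b) (w := a)
    rw [SimpleGraph.dist_comm (u := b) (v := a)] at h3
    have h4 : Z.dist b x ≤ Z.dist a b := by omega
    have h4 : (Z.dist b x : ℝ) ≤ Z.dist a b := by exact_mod_cast h4
    have h5 := dist_map_le_mul hZ hf b x
    have h6 : M * (Z.dist b x : ℝ) ≤ M * (2 * M + c) :=
      mul_le_mul_of_nonneg_left (by linarith) hM
    have h7 := dist_triangle_left (f x) m (f b)
    have h8 := hf' u v
    linarith
  rcases hX.segment_subset_union _ (f w) _ hm with hm | hm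
  · exact key u hu hum (exists_dist_le_of_mem_segment hX hZ hM hf hm)
  · have hm' : m ∈ hX.segment (f v) (f w) := hX.segment_comm (f w) (f v) ▸ hm
    exact key v hv (by rw [dist_comm, hmv]; ring) (exists_dist_le_of_mem_segment hX hZ hM hf hm')

theorem abs_dist_sub_le_of_realTree (hX : IsRealTree X) (hZ : Z.Connected) (hM : 0 ≤ M)
    (hc : 0 ≤ c) (hf : ∀ a b, Z.Adj a b → dist (f a) (f b) ≤ M)
    (hf' : ∀ a b, (Z.dist a b : ℝ) ≤ dist (f a) (f b) + c) (w u v : V) :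
    |(Z.dist u v : ℝ) - dist ((componentTree Z w).tip u) ((componentTree Z w).tip v)| ≤
      2 * (M * (2 * M + c) + M) + c + 1 := by
  rw [RootedTreeData.Tree.dist_tip_tip, level_componentTree, level_componentTree]
  have hl := linked_meet hZ w u v
  have hmax : ∀ n, Linked Z w n u v → n ≤ (componentTree Z w).meet u v :=
    fun n => le_meet_of_linked
  set n := (componentTree Z w).meet u v
  obtain ⟨x, hx, hxu, hxd⟩ := exists_linked_dist_eq hZ w hl.le_left
  obtain ⟨y, hy, hyv, hyd⟩ := exists_linked_dist_eq hZ w hl.le_right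
  have hxy := dist_le_of_linked_of_dist_eq hX hZ hM hf hf' hx hy ((hxu.trans hl).trans hyv.symm)
  have hK : 0 ≤ M * (2 * M + c) := by positivity
  rw [abs_le]
  constructor
  · have : Z.dist w u + Z.dist w v ≤ 2 * n + Z.dist u v + 1 := by
      by_contra! hlt
      have := hmax (n + 1) (linked_of_two_mul_add_dist_le hZ w (by omega))
      omega
    have : (Z.dist w u : ℝ) + Z.dist w v ≤ 2 * n + Z.dist u v + 1 := by exact_mod_cast this
    linarith
  · have h1 := hZ.dist_triangle (u := u) (v := x) (w := v)
    have h2 := hZ.dist_triangle (u := x) (v := y) (w := v)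
    rw [SimpleGraph.dist_comm (u := u) (v := x)] at h1
    have : Z.dist u v + 2 * n ≤ Z.dist w u + Z.dist w v + Z.dist x y := by omega
    have : (Z.dist u v : ℝ) + 2 * n ≤ Z.dist w u + Z.dist w v + Z.dist x y := by
      exact_mod_cast this
    linarith

end Graph

theorem countable_of_fg {G : Type v} [Group G] (hG : Group.FG G) : Countable G := by
  obtain ⟨S, hS, φ, hφ⟩ := Group.fg_iff_exists_freeGroup_hom_surjective_finite.1 hG
  exact hφ.countable

/-! ### Cayley graphs of quasi-actions -/

section Orbit

variable {G : Type v} [Group G] {X : Type u} [MetricSpace X]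

/-- The graph on the group in which `g` and `h` are adjacent if some common left translate moves
the base point `x` to points at distance at most `R`. -/
def orbitGraph (A : G → X → X) (x : X) (R : ℝ) : SimpleGraph G where
  Adj g h := g ≠ h ∧ ∃ k, dist (A (k * g) x) (A (k * h) x) ≤ R
  symm := ⟨fun _ _ ⟨hne, k, hk⟩ => ⟨hne.symm, k, by rwa [dist_comm]⟩⟩
  loopless := ⟨fun _ h => h.1 rfl⟩

variable {A : G → X → X} {x : X} {R : ℝ}

theorem orbitGraph_adj_mul (k : G) {g h : G} (hgh : (orbitGraph A x R).Adj g h) :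
    (orbitGraph A x R).Adj (k * g) (k * h) := by
  obtain ⟨hne, l, hl⟩ := hgh
  exact ⟨fun h => hne (mul_left_cancel h), l * k⁻¹, by simpa [mul_assoc] using hl⟩

theorem dist_orbitGraph_mul_le (hZ : (orbitGraph A x R).Connected) (k g h : G) :
    (orbitGraph A x R).dist (k * g) (k * h) ≤ (orbitGraph A x R).dist g h := by
  obtain ⟨p, hp⟩ := hZ.exists_walk_length_eq_dist g h
  let φ : orbitGraph A x R →g orbitGraph A x R := ⟨fun g => k * g, orbitGraph_adj_mul k⟩
  rw [← hp, ← p.length_map φ]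
  exact SimpleGraph.dist_le (p.map φ)

theorem dist_orbitGraph_mul (hZ : (orbitGraph A x R).Connected) (k g h : G) :
    (orbitGraph A x R).dist (k * g) (k * h) = (orbitGraph A x R).dist g h := by
  refine le_antisymm (dist_orbitGraph_mul_le hZ k g h) ?_
  have := dist_orbitGraph_mul_le hZ k⁻¹ (k * g) (k * h)
  rwa [inv_mul_cancel_left, inv_mul_cancel_left] at this

theorem dist_orbit_le_of_adj {L C : ℝ} (hA : IsQuasiAction L C A) {g h : G}
    (hgh : (orbitGraph A x R).Adj g h) : dist (A g x) (A h x) ≤ L * R + 3 * C := by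
  obtain ⟨-, k, hk⟩ := hgh
  have h1 := hA.dist_mul_le k⁻¹ (k * g) x
  have h2 := hA.dist_mul_le k⁻¹ (k * h) x
  have h3 := (hA.quasiIsometry k⁻¹).upper (A (k * g) x) (A (k * h) x)
  rw [inv_mul_cancel_left] at h1 h2
  have h4 := dist_triangle4 (A g x) (A k⁻¹ (A (k * g) x)) (A k⁻¹ (A (k * h) x)) (A h x)
  rw [dist_comm (A k⁻¹ _) (A g x)] at h1
  have h5 := mul_le_mul_of_nonneg_left hk (zero_le_one.trans hA.one_le)
  linarith

theorem exists_walk_orbitGraph (hX : IsRealTree X) {D : ℝ} (hD0 : 0 ≤ D)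
    (hD : ∀ y : X, ∃ g, dist (A g x) y ≤ D) {n : ℕ} {g h : G} {y : X}
    (hy : dist (A g x) y ≤ D) (hn : dist y (A h x) ≤ n) :
    ∃ p : (orbitGraph A x (2 * D + 1)).Walk g h, p.length ≤ n + 1 := by
  have hadj : ∀ g g' : G, dist (A g x) (A g' x) ≤ 2 * D + 1 →
      g = g' ∨ (orbitGraph A x (2 * D + 1)).Adj g g' := fun g g' hd =>
    or_iff_not_imp_left.2 fun hne => ⟨hne, 1, by simpa using hd⟩
  induction n generalizing g y with
  | zero =>
    have h1 := dist_triangle (A g x) y (A h x)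
    rw [Nat.cast_zero] at hn
    rcases hadj g h (by linarith) with rfl | h
    · exact ⟨.nil, by simp⟩
    · exact ⟨.cons h .nil, by simp⟩
  | succ n ih =>
    rcases le_or_gt (dist y (A h x)) n with hle | hlt
    · obtain ⟨p, hp⟩ := ih hy hle
      exact ⟨p, by omega⟩
    rcases le_or_gt (dist y (A h x)) 1 with h1 | h1
    · have h2 := dist_triangle (A g x) y (A h x)
      rcases hadj g h (by linarith) with rfl | h
      · exact ⟨.nil, by simp⟩
      · exact ⟨.cons h .nil, by simp⟩
    obtain ⟨m, -, hm1, hm2⟩ := hX.exists_mem_segment (x := y) (y := A h x) (t := 1)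
      ⟨zero_le_one, h1.le⟩
    obtain ⟨g', hg'⟩ := hD m
    push_cast at hn
    obtain ⟨p, hp⟩ := ih hg' (by linarith)
    have h2 := dist_triangle4 (A g x) y m (A g' x)
    rw [dist_comm m] at h2
    rcases hadj g g' (by linarith) with rfl | hgg
    · exact ⟨p, by omega⟩
    · exact ⟨.cons hgg p, by simpa using hp⟩

theorem connected_orbitGraph (hX : IsRealTree X) {D : ℝ} (hD0 : 0 ≤ D)
    (hD : ∀ y : X, ∃ g, dist (A g x) y ≤ D) : (orbitGraph A x (2 * D + 1)).Connected := by
  have : Nonempty G := ⟨1⟩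
  refine SimpleGraph.Connected.mk fun g h => ?_
  obtain ⟨n, hn⟩ := exists_nat_ge (dist (A g x) (A h x))
  obtain ⟨p, -⟩ := exists_walk_orbitGraph hX hD0 hD (g := g) (by rwa [dist_self]) hn
  exact ⟨p⟩

theorem dist_orbitGraph_le (hX : IsRealTree X) {D : ℝ} (hD0 : 0 ≤ D)
    (hD : ∀ y : X, ∃ g, dist (A g x) y ≤ D) (g h : G) :
    ((orbitGraph A x (2 * D + 1)).dist g h : ℝ) ≤ dist (A g x) (A h x) + 2 := by
  obtain ⟨p, hp⟩ := exists_walk_orbitGraph hX hD0 hD (g := g) (by rwa [dist_self])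
    (Nat.le_ceil (dist (A g x) (A h x)))
  have h1 : ((orbitGraph A x (2 * D + 1)).dist g h : ℝ) ≤ ⌈dist (A g x) (A h x)⌉₊ + 1 := by
    exact_mod_cast (SimpleGraph.dist_le p).trans hp
  linarith [Nat.ceil_lt_add_one (@dist_nonneg _ _ (A g x) (A h x))]

end Orbit

/-! ### Quasi-actions from almost invariant maps of the group -/

section AlmostInvariant

variable {G : Type v} [Group G] {Y : Type w} [MetricSpace Y] {p : G → Y} {q : Y → G} {K : ℝ}

theorem isQuasiAction_of_almost_invariant (hK : 0 ≤ K)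
    (hp : ∀ k g h, |dist (p (k * g)) (p (k * h)) - dist (p g) (p h)| ≤ K)
    (hq : ∀ y, dist (p (q y)) y ≤ 1) :
    IsQuasiAction 1 (K + 2) fun g y => p (g * q y) := by
  have hup : ∀ k g h, dist (p (k * g)) (p (k * h)) ≤ dist (p g) (p h) + K := fun k g h => by
    linarith [(abs_le.1 (hp k g h)).2]
  have hlow : ∀ k g h, dist (p g) (p h) ≤ dist (p (k * g)) (p (k * h)) + K := fun k g h => by
    linarith [(abs_le.1 (hp k g h)).1]
  refine ⟨le_rfl, by linarith, fun g => ⟨le_rfl, by linarith, ?_, ?_, ?_⟩, ?_⟩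
  · intro y z
    have h1 := hlow g (q y) (q z)
    have h2 := dist_triangle4 y (p (q y)) (p (q z)) z
    rw [dist_comm y (p (q y))] at h2
    linarith [hq y, hq z]
  · intro y z
    have h1 := hup g (q y) (q z)
    have h2 := dist_triangle4 (p (q y)) y z (p (q z))
    rw [dist_comm z (p (q z))] at h2
    linarith [hq y, hq z]
  · intro y
    refine ⟨p (g⁻¹ * q y), ?_⟩
    have h1 := hup g (q (p (g⁻¹ * q y))) (g⁻¹ * q y)
    rw [mul_inv_cancel_left] at h1
    have h2 := dist_triangle (p (g * q (p (g⁻¹ * q y)))) (p (q y)) y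
    linarith [hq y, hq (p (g⁻¹ * q y))]
  · intro g h y
    have h1 := hup g (q (p (h * q y))) (h * q y)
    rw [← mul_assoc] at h1
    linarith [hq (p (h * q y))]

theorem areQuasiConjugate_of_almost_invariant {X : Type u} [MetricSpace X] {A : G → X → X}
    {L C M D c₁ c₂ : ℝ} {x : X} (hA : IsQuasiAction L C A) (hK : 0 ≤ K) (hM : 1 ≤ M)
    (hD0 : 0 ≤ D) (hc₁ : 0 ≤ c₁) (hc₂ : 0 ≤ c₂) (hD : ∀ y : X, ∃ g, dist (A g x) y ≤ D)
    (hp : ∀ k g h, |dist (p (k * g)) (p (k * h)) - dist (p g) (p h)| ≤ K)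
    (hq : ∀ y, dist (p (q y)) y ≤ 1)
    (h₁ : ∀ g h, dist (p g) (p h) ≤ dist (A g x) (A h x) + c₁)
    (h₂ : ∀ g h, dist (A g x) (A h x) ≤ M * dist (p g) (p h) + c₂) :
    AreQuasiConjugate A fun g y => p (g * q y) := by
  choose r hr using hD
  have hL : 0 ≤ L := zero_le_one.trans hA.one_le
  have hC := hA.nonneg
  refine ⟨fun z => p (r z), ⟨D + L * D + 2 * C + c₁ + 1 + K, by positivity, ?_⟩, M,
    2 * D + c₁ + c₂ + 1, hM, by positivity, ?_, ?_, ?_⟩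
  · intro z g
    have e1 := h₁ (r (A g z)) (g * r z)
    have e2 := dist_triangle4 (A (r (A g z)) x) (A g z) (A g (A (r z) x)) (A (g * r z) x)
    have e3 := (hA.quasiIsometry g).upper z (A (r z) x)
    have e4 := hr z
    rw [dist_comm] at e4
    have e5 := mul_le_mul_of_nonneg_left e4 hL
    have e6 := hA.dist_mul_le g (r z) x
    have e7 := (abs_le.1 (hp g (r z) (q (p (r z))))).2
    have e8 := hq (p (r z))
    rw [dist_comm] at e8
    have e9 := dist_triangle (p (r (A g z))) (p (g * r z)) (p (g * q (p (r z))))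
    have e10 := hr (A g z)
    linarith
  · intro y z
    have e1 := h₂ (r y) (r z)
    have e2 := dist_triangle4 y (A (r y) x) (A (r z) x) z
    have e3 := hr y
    rw [dist_comm] at e3
    have e4 := hr z
    have hM0 : 0 < M := zero_lt_one.trans_le hM
    rw [sub_le_iff_le_add, one_div, inv_mul_le_iff₀ hM0]
    have e5 : 2 * D + c₁ + c₂ + 1 ≤ M * (2 * D + c₁ + c₂ + 1) :=
      le_mul_of_one_le_left (by positivity) hM
    linarith
  · intro y z
    have e1 := h₁ (r y) (r z)
    have e2 := dist_triangle4 (A (r y) x) y z (A (r z) x)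
    have e3 := hr z
    rw [dist_comm] at e3
    have e4 := hr y
    have e5 : dist y z ≤ M * dist y z := le_mul_of_one_le_left dist_nonneg hM
    linarith
  · intro y
    refine ⟨A (q y) x, ?_⟩
    have e1 := h₁ (r (A (q y) x)) (q y)
    have e2 := dist_triangle (p (r (A (q y) x))) (p (q y)) y
    linarith [hr (A (q y) x), hq y]

end AlmostInvariant

/-- Restrict the set of rays. -/
def RootedTreeData.comap {I : Type v} {J : Type u} (T : RootedTreeData I) (f : J → I) :
    RootedTreeData J where
  level j := T.level (f j)
  meet i j := T.meet (f i) (f j)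
  meet_self i := T.meet_self (f i)
  meet_comm i j := T.meet_comm (f i) (f j)
  min_meet_le i j k := T.min_meet_le (f i) (f j) (f k)

theorem isQuasiAction_of_isEmpty {G : Type v} [Group G] {X : Type u} [MetricSpace X] [IsEmpty X]
    (A : G → X → X) : IsQuasiAction 1 0 A :=
  ⟨le_rfl, le_rfl, fun _ => ⟨le_rfl, le_rfl, isEmptyElim, isEmptyElim, isEmptyElim⟩,
    fun _ _ => isEmptyElim⟩

end QuasiTree

theorem mainTheorem7 {G : Type v} [Group G] (hG : Group.FG G)
    {X : Type u} [MetricSpace X] (hX : QuasiTree.IsSimplicialTree X)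
    (L C : ℝ) (A : G → X → X) (hA : QuasiTree.IsQuasiAction L C A)
    (hcob : QuasiTree.IsCobounded A) :
    ∃ (Y : Type u) (_ : MetricSpace Y) (C' : ℝ) (B : G → Y → Y),
      QuasiTree.IsSimplicialTree Y ∧
      QuasiTree.IsQuasiAction 1 C' B ∧
      QuasiTree.AreQuasiConjugate A B := by
  open QuasiTree in
  rcases isEmpty_or_nonempty X with hemp | ⟨⟨x⟩⟩
  · exact ⟨X, inferInstance, 0, A, hX, isQuasiAction_of_isEmpty A, id,
      ⟨0, le_rfl, isEmptyElim⟩, 1, 0, le_rfl, le_rfl, isEmptyElim, isEmptyElim, isEmptyElim⟩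
  have := countable_of_fg hG
  have : Small.{u} G := Countable.toSmall G
  obtain ⟨D, hD0, hD⟩ := hcob
  replace hD := hD x
  have hL := hA.one_le
  have hC := hA.nonneg
  set Z := orbitGraph A x (2 * D + 1) with hZdef
  have hZ : Z.Connected := connected_orbitGraph hX.1 hD0 hD
  set M := L * (2 * D + 1) + 3 * C with hMdef
  have hM : 1 ≤ M := by nlinarith
  have hf : ∀ g h, Z.Adj g h → dist (A g x) (A h x) ≤ M := fun g h => dist_orbit_le_of_adj hA
  have hf' := dist_orbitGraph_le hX.1 hD0 hD
  set K := 2 * (M * (2 * M + 2) + M) + 2 + 1 with hKdef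
  have hK : 0 ≤ K := by positivity
  let e := equivShrink.{u} G
  let T : RootedTreeData (Shrink.{u} G) := (componentTree Z 1).comap e.symm
  let p : G → T.Tree := fun g => T.tip (e g)
  have hpd : ∀ g h, |(Z.dist g h : ℝ) - dist (p g) (p h)| ≤ K := fun g h => by
    have := abs_dist_sub_le_of_realTree hX.1 hZ (zero_le_one.trans hM) zero_le_two hf hf' 1 g h
    rw [RootedTreeData.Tree.dist_tip_tip] at this ⊢
    simpa only [T, RootedTreeData.comap, e, Equiv.symm_apply_apply] using this
  have hpu : ∀ g h, dist (p g) (p h) ≤ Z.dist g h + K := fun g h => by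
    linarith [(abs_le.1 (hpd g h)).1]
  have hpl : ∀ g h, (Z.dist g h : ℝ) ≤ dist (p g) (p h) + K := fun g h => by
    linarith [(abs_le.1 (hpd g h)).2]
  have hp : ∀ k g h, |dist (p (k * g)) (p (k * h)) - dist (p g) (p h)| ≤ 2 * K := by
    intro k g h
    have h1 := hpu (k * g) (k * h)
    have h2 := hpl (k * g) (k * h)
    rw [dist_orbitGraph_mul hZ] at h1 h2
    rw [abs_le]
    constructor <;> linarith [hpu g h, hpl g h]
  have hsurj : ∀ y, ∃ g, dist (p g) y ≤ 1 := by
    intro y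
    obtain ⟨i, hi⟩ := RootedTreeData.Tree.exists_dist_tip_le (T := T) (fun i n hn => by
      obtain ⟨g, hg, hg'⟩ := exists_level_eq_and_meet_eq hZ 1 (e.symm i) hn
      refine ⟨e g, ?_, ?_⟩
      · simpa only [T, RootedTreeData.comap, Equiv.symm_apply_apply] using hg
      · simpa only [T, RootedTreeData.comap, Equiv.symm_apply_apply] using hg') y
    exact ⟨e.symm i, by simpa only [p, Equiv.apply_symm_apply] using hi⟩
  choose q hq using hsurj
  refine ⟨T.Tree, inferInstance, 2 * K + 2, fun g y => p (g * q y),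
    RootedTreeData.Tree.isSimplicialTree T,
    isQuasiAction_of_almost_invariant (by positivity) hp hq,
    areQuasiConjugate_of_almost_invariant (c₁ := 2 + K) (c₂ := M * K) hA (by positivity) hM hD0
      (by positivity) (by positivity) hD hp hq ?_ ?_⟩
  · intro g h
    linarith [hpu g h, hf' g h]
  · intro g h
    have h1 := dist_map_le_mul hZ hf g h
    have h2 := mul_le_mul_of_nonneg_left (hpl g h) (zero_le_one.trans hM)
    linarith
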